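/- Let $\lambda>1$ be a real number. A (real) Banach lattice $P$ is called $\lambda$-projective if, whenever $X$ is a Banach lattice, $J$ is a closed ideal of $X$ with quotient map $Q\colon X\to X/J$, and $T\colon P\to X/J$ is a Banach lattice homomorphism, there is a Banach lattice homomorphism $\hat T\colon P\to X$ such that $T=Q\circ\hat T$ and $\|\hat T\|\le\lambda\|T\|$. It is called $\infty$-projective if it is $\lambda$-projective for some real $\lambda>1$. **Corollary.** The Banach lattice $c_0$ (real null sequences) is not $\infty$-projective, and for every $p$ with $2\le p<\infty$ the Banach lattice $\ell_p$ (real $p$-summable sequences) is not $\infty$-projective. Here both spaces are indexed by $\mathbb{N}$ and carry their usual norms and the coordinatewise order. -/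

import Mathlib

open Set Filter Topology
open scoped ENNReal ZeroAtInfty

universe u v

/-! ### Banach lattices -/

/-- A (real) Banach lattice: a complete real normed space which is a vector lattice and whose norm
satisfies `|x| ≤ |y| → ‖x‖ ≤ ‖y‖`. -/
class BanachLattice (X : Type u) [NormedAddCommGroup X] [NormedSpace ℝ X] [Lattice X] : Prop
    extends IsOrderedAddMonoid X, IsOrderedModule ℝ X, HasSolidNorm X, CompleteSpace X

/-- A Banach lattice homomorphism: a bounded linear operator preserving `⊔` and `⊓`. -/
structure BanachLatticeHom (X : Type u) (Y : Type v)
    [NormedAddCommGroup X] [NormedSpace ℝ X] [Lattice X]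
    [NormedAddCommGroup Y] [NormedSpace ℝ Y] [Lattice Y] extends X →L[ℝ] Y where
  map_sup' : ∀ x y : X, toFun (x ⊔ y) = toFun x ⊔ toFun y
  map_inf' : ∀ x y : X, toFun (x ⊓ y) = toFun x ⊓ toFun y

/-- A closed (order) ideal of `X`: a closed solid linear subspace, where solid means that
`x ∈ J` and `|y| ≤ |x|` imply `y ∈ J`. -/
class IsClosedIdeal {X : Type u} [NormedAddCommGroup X] [NormedSpace ℝ X] [Lattice X]
    (J : Submodule ℝ X) : Prop where
  isClosed : IsClosed (J : Set X)
  isSolid : LatticeOrderedAddCommGroup.IsSolid (J : Set X)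

/-! ### The quotient Banach lattice `X ⧸ J`

The norm on `X ⧸ J` is Mathlib's quotient norm. -/

namespace IsClosedIdeal

variable {X : Type u} [NormedAddCommGroup X] [NormedSpace ℝ X] [Lattice X]
  (J : Submodule ℝ X) [IsClosedIdeal J]

instance instIsClosed : IsClosed (J : Set X) := IsClosedIdeal.isClosed

variable {J}

theorem mem_of_abs_le {x y : X} (hx : x ∈ J) (h : |y| ≤ |x|) : y ∈ J :=
  IsClosedIdeal.isSolid (J := J) hx h

variable [BanachLattice X]

theorem abs_mem {x : X} (hx : x ∈ J) : |x| ∈ J := mem_of_abs_le hx (abs_abs x).le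

theorem mem_of_nonneg_of_le {x y : X} (hx : x ∈ J) (h0 : 0 ≤ y) (h : y ≤ x) : y ∈ J :=
  mem_of_abs_le hx (by rw [abs_of_nonneg h0]; exact h.trans (le_abs_self x))

theorem sup_sub_sup_mem {a b c d : X} (h₁ : a - c ∈ J) (h₂ : b - d ∈ J) :
    a ⊔ b - c ⊔ d ∈ J := by
  have e : a ⊔ b - c ⊔ d = (a ⊔ b - c ⊔ b) + (c ⊔ b - c ⊔ d) := by abel
  rw [e]
  refine J.add_mem (mem_of_abs_le h₁ (abs_sup_sub_sup_le_abs a c b)) (mem_of_abs_le h₂ ?_)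
  rw [sup_comm c b, sup_comm c d]
  exact abs_sup_sub_sup_le_abs b d c

theorem inf_sub_inf_mem {a b c d : X} (h₁ : a - c ∈ J) (h₂ : b - d ∈ J) :
    a ⊓ b - c ⊓ d ∈ J := by
  have e : a ⊓ b - c ⊓ d = (a ⊓ b - c ⊓ b) + (c ⊓ b - c ⊓ d) := by abel
  rw [e]
  refine J.add_mem (mem_of_abs_le h₁ (abs_inf_sub_inf_le_abs a c b)) (mem_of_abs_le h₂ ?_)
  rw [inf_comm c b, inf_comm c d]
  exact abs_inf_sub_inf_le_abs b d c

variable (J)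

/-- The quotient order: a class lies below another one if they have representatives in that
relation. The lattice operations are those of representatives. -/
instance instLattice : Lattice (X ⧸ J) where
  le a b := ∃ x y : X, J.mkQ x = a ∧ J.mkQ y = b ∧ x ≤ y
  sup := Quotient.map₂ (fun x y : X => x ⊔ y) (by
    intro a c h₁ b d h₂
    exact (Submodule.quotientRel_def J).2 (sup_sub_sup_mem
      ((Submodule.quotientRel_def J).1 h₁) ((Submodule.quotientRel_def J).1 h₂)))
  inf := Quotient.map₂ (fun x y : X => x ⊓ y) (by
    intro a c h₁ b d h₂
    exact (Submodule.quotientRel_def J).2 (inf_sub_inf_mem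
      ((Submodule.quotientRel_def J).1 h₁) ((Submodule.quotientRel_def J).1 h₂)))
  le_refl a := by
    obtain ⟨x, rfl⟩ := J.mkQ_surjective a
    exact ⟨x, x, rfl, rfl, le_rfl⟩
  le_trans a b c := by
    rintro ⟨x, y, rfl, rfl, hxy⟩ ⟨y', z, hy, rfl, hz⟩
    have hj : y - y' ∈ J := (Submodule.Quotient.eq J).1 hy.symm
    refine ⟨x, z + (y - y'), rfl, ?_, ?_⟩
    · rw [map_add, show J.mkQ (y - y') = 0 from (Submodule.Quotient.mk_eq_zero J).2 hj, add_zero]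
    · calc x ≤ y := hxy
        _ = y' + (y - y') := by abel
        _ ≤ z + (y - y') := by gcongr
  le_antisymm a b := by
    rintro ⟨x, y, rfl, rfl, hxy⟩ ⟨y', x', hy, hx, hyx⟩
    have h1 : y - y' ∈ J := (Submodule.Quotient.eq J).1 hy.symm
    have h2 : x' - x ∈ J := (Submodule.Quotient.eq J).1 hx
    refine ((Submodule.Quotient.eq J).2 ?_).symm
    refine mem_of_nonneg_of_le (J.add_mem h1 h2) (sub_nonneg.2 hxy) ?_
    have e : (y - y') + (x' - x) = (y - x) + (x' - y') := by abel
    rw [e]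
    exact le_add_of_nonneg_right (sub_nonneg.2 hyx)
  le_sup_left a b := by
    obtain ⟨x, rfl⟩ := J.mkQ_surjective a
    obtain ⟨y, rfl⟩ := J.mkQ_surjective b
    exact ⟨x, x ⊔ y, rfl, rfl, le_sup_left⟩
  le_sup_right a b := by
    obtain ⟨x, rfl⟩ := J.mkQ_surjective a
    obtain ⟨y, rfl⟩ := J.mkQ_surjective b
    exact ⟨y, x ⊔ y, rfl, rfl, le_sup_right⟩
  sup_le a b c := by
    rintro ⟨x, z, rfl, rfl, h₁⟩ ⟨y, z', rfl, hz, h₂⟩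
    have hj : z' - z ∈ J := (Submodule.Quotient.eq J).1 hz
    refine ⟨x ⊔ y, z ⊔ z', rfl, ?_, sup_le_sup h₁ h₂⟩
    have h := sup_sub_sup_mem (J := J) (a := z) (b := z') (c := z) (d := z) (by simp) hj
    rw [sup_idem] at h
    exact (Submodule.Quotient.eq J).2 h
  inf_le_left a b := by
    obtain ⟨x, rfl⟩ := J.mkQ_surjective a
    obtain ⟨y, rfl⟩ := J.mkQ_surjective b
    exact ⟨x ⊓ y, x, rfl, rfl, inf_le_left⟩
  inf_le_right a b := by
    obtain ⟨x, rfl⟩ := J.mkQ_surjective a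
    obtain ⟨y, rfl⟩ := J.mkQ_surjective b
    exact ⟨x ⊓ y, y, rfl, rfl, inf_le_right⟩
  le_inf c a b := by
    rintro ⟨z, x, rfl, rfl, h₁⟩ ⟨z', y, hz, rfl, h₂⟩
    have hj : z' - z ∈ J := (Submodule.Quotient.eq J).1 hz
    refine ⟨z ⊓ z', x ⊓ y, ?_, rfl, inf_le_inf h₁ h₂⟩
    have h := inf_sub_inf_mem (J := J) (a := z) (b := z') (c := z) (d := z) (by simp) hj
    rw [inf_idem] at h
    exact (Submodule.Quotient.eq J).2 h

theorem mkQ_sup (x y : X) : J.mkQ (x ⊔ y) = J.mkQ x ⊔ J.mkQ y := rfl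

theorem mkQ_inf (x y : X) : J.mkQ (x ⊓ y) = J.mkQ x ⊓ J.mkQ y := rfl

theorem mkQ_abs (x : X) : J.mkQ |x| = |J.mkQ x| := rfl

theorem mkQ_mono {x y : X} (h : x ≤ y) : J.mkQ x ≤ J.mkQ y := ⟨x, y, rfl, rfl, h⟩

instance instIsOrderedAddMonoid : IsOrderedAddMonoid (X ⧸ J) where
  add_le_add_left a b h c := by
    obtain ⟨x, y, rfl, rfl, hxy⟩ := h
    obtain ⟨z, rfl⟩ := J.mkQ_surjective c
    rw [← map_add, ← map_add]
    exact mkQ_mono J (by gcongr)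

/-- The quotient of a Banach lattice by a closed ideal is a Banach lattice. -/
instance instBanachLattice : BanachLattice (X ⧸ J) where
  smul_le_smul_of_nonneg_left r hr a b h := by
    obtain ⟨x, y, rfl, rfl, hxy⟩ := h
    show r • J.mkQ x ≤ r • J.mkQ y
    rw [← map_smul, ← map_smul]
    exact mkQ_mono J (smul_le_smul_of_nonneg_left hxy hr)
  smul_le_smul_of_nonneg_right b hb r s hrs := by
    obtain ⟨x, y, hx, rfl, hxy⟩ := hb
    have h0 : (0 : X ⧸ J) ≤ J.mkQ (y - x) :=
      (map_zero J.mkQ).symm.le.trans (mkQ_mono J (sub_nonneg.2 hxy))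
    have e : J.mkQ y = J.mkQ (y - x) := by rw [map_sub, hx, sub_zero]
    show r • J.mkQ y ≤ s • J.mkQ y
    rw [e, ← map_smul, ← map_smul]
    exact mkQ_mono J (smul_le_smul_of_nonneg_right hrs (sub_nonneg.2 hxy))
  solid a b hab := by
    refine le_of_forall_pos_le_add fun ε hε => ?_
    obtain ⟨y, rfl, hy⟩ := Submodule.Quotient.norm_mk_lt b hε
    obtain ⟨x, rfl⟩ := J.mkQ_surjective a
    have hx : J.mkQ ((x ⊓ |y|) ⊔ (-|y|)) = J.mkQ x := by
      change |J.mkQ x| ≤ |J.mkQ y| at hab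
      rw [mkQ_sup, mkQ_inf, map_neg, mkQ_abs, inf_eq_left.2 ((le_abs_self _).trans hab)]
      exact sup_eq_left.2 (neg_le.1 ((neg_le_abs _).trans hab))
    have hxy : |(x ⊓ |y|) ⊔ (-|y|)| ≤ |y| :=
      sup_le (sup_le inf_le_right ((neg_nonpos.2 (abs_nonneg y)).trans (abs_nonneg y)))
        (neg_le.1 le_sup_right)
    rw [← hx]
    calc ‖J.mkQ ((x ⊓ |y|) ⊔ (-|y|))‖ ≤ ‖(x ⊓ |y|) ⊔ (-|y|)‖ :=
          Submodule.Quotient.norm_mk_le J _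
      _ ≤ ‖y‖ := norm_le_norm_of_abs_le_abs hxy
      _ ≤ _ := hy.le

end IsClosedIdeal

/-! ### Projectivity -/

/-- `P` is `l`-projective: every Banach lattice homomorphism `T` from `P` into a quotient `X ⧸ J`
of a Banach lattice by a closed ideal lifts to a Banach lattice homomorphism `T'` from `P` to `X`
with `‖T'‖ ≤ l * ‖T‖`. -/
def IsLambdaProjective (l : ℝ) (P : Type u)
    [NormedAddCommGroup P] [NormedSpace ℝ P] [Lattice P] [BanachLattice P] : Prop :=
  ∀ (X : Type u) [NormedAddCommGroup X] [NormedSpace ℝ X] [Lattice X] [BanachLattice X]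
    (J : Submodule ℝ X) [IsClosedIdeal J] (T : BanachLatticeHom P (X ⧸ J)),
    ∃ T' : BanachLatticeHom P X,
      (∀ x : P, J.mkQ (T'.toContinuousLinearMap x) = T.toContinuousLinearMap x) ∧
        ‖T'.toContinuousLinearMap‖ ≤ l * ‖T.toContinuousLinearMap‖

/-- `P` is `∞`-projective if it is `l`-projective for some real `l > 1`. -/
def IsInftyProjective (P : Type u)
    [NormedAddCommGroup P] [NormedSpace ℝ P] [Lattice P] [BanachLattice P] : Prop :=
  ∃ l : ℝ, 1 < l ∧ IsLambdaProjective l P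

/-! ### `c₀` as a Banach lattice: `C₀(ℕ, ℝ)` with the supremum norm and the pointwise order -/

namespace ZeroAtInftyContinuousMap

instance instPartialOrderReal : PartialOrder C₀(ℕ, ℝ) :=
  PartialOrder.lift (fun f => (f : ℕ → ℝ)) DFunLike.coe_injective

instance instMaxReal : Max C₀(ℕ, ℝ) where
  max f g :=
    { toFun := fun n => f n ⊔ g n
      continuous_toFun := f.continuous.sup g.continuous
      zero_at_infty' := by
        simpa using (zero_at_infty f).sup_nhds (zero_at_infty g) }

instance instMinReal : Min C₀(ℕ, ℝ) where
  min f g :=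
    { toFun := fun n => f n ⊓ g n
      continuous_toFun := f.continuous.inf g.continuous
      zero_at_infty' := by
        simpa using (zero_at_infty f).inf_nhds (zero_at_infty g) }

instance instLatticeReal : Lattice C₀(ℕ, ℝ) :=
  DFunLike.coe_injective.lattice _ .rfl .rfl (fun _ _ => rfl) (fun _ _ => rfl)

instance instIsOrderedAddMonoidReal : IsOrderedAddMonoid C₀(ℕ, ℝ) where
  add_le_add_left _ _ h k := fun n => add_le_add_left (h n) (k n)

instance instBanachLatticeReal : BanachLattice C₀(ℕ, ℝ) where
  smul_le_smul_of_nonneg_left _ hr _ _ h := fun n => mul_le_mul_of_nonneg_left (h n) hr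
  smul_le_smul_of_nonneg_right _ hb _ _ h := fun n => mul_le_mul_of_nonneg_right h (hb n)
  solid f g h := by
    have h' : ∀ n, |f n| ≤ |g n| := h
    rw [← norm_toBCF_eq_norm, ← norm_toBCF_eq_norm]
    exact (BoundedContinuousFunction.norm_le (norm_nonneg _)).2
      fun n => (h' n).trans (g.toBCF.norm_coe_le_norm n)

end ZeroAtInftyContinuousMap

/-! ### `ℓ_p` as a Banach lattice, with the pointwise order -/

namespace lp

variable {p : ℝ≥0∞}

instance instPartialOrderReal : PartialOrder (lp (fun _ : ℕ => ℝ) p) :=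
  PartialOrder.lift (fun f => (f : ℕ → ℝ)) fun _ _ h => lp.ext h

theorem memℓp_sup (f g : lp (fun _ : ℕ => ℝ) p) : Memℓp (fun n => f n ⊔ g n) p :=
  (f.2.norm.add g.2.norm).mono fun _ =>
    abs_max_le_max_abs_abs.trans (max_le_add_of_nonneg (abs_nonneg _) (abs_nonneg _))

theorem memℓp_inf (f g : lp (fun _ : ℕ => ℝ) p) : Memℓp (fun n => f n ⊓ g n) p :=
  (f.2.norm.add g.2.norm).mono fun _ =>
    abs_min_le_max_abs_abs.trans (max_le_add_of_nonneg (abs_nonneg _) (abs_nonneg _))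

instance instMaxReal : Max (lp (fun _ : ℕ => ℝ) p) where
  max f g := ⟨fun n => f n ⊔ g n, memℓp_sup f g⟩

instance instMinReal : Min (lp (fun _ : ℕ => ℝ) p) where
  min f g := ⟨fun n => f n ⊓ g n, memℓp_inf f g⟩

instance instLatticeReal : Lattice (lp (fun _ : ℕ => ℝ) p) :=
  Function.Injective.lattice (fun f : lp (fun _ : ℕ => ℝ) p => (f : ℕ → ℝ))
    (fun _ _ h => lp.ext h) .rfl .rfl (fun _ _ => rfl) (fun _ _ => rfl)

instance instIsOrderedAddMonoidReal : IsOrderedAddMonoid (lp (fun _ : ℕ => ℝ) p) where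
  add_le_add_left _ _ h k := fun n => add_le_add_left (h n) (k n)

instance instBanachLatticeReal [hp : Fact (1 ≤ p)] : BanachLattice (lp (fun _ : ℕ => ℝ) p) where
  smul_le_smul_of_nonneg_left _ hr _ _ h := fun n => mul_le_mul_of_nonneg_left (h n) hr
  smul_le_smul_of_nonneg_right _ hb _ _ h := fun n => mul_le_mul_of_nonneg_right h (hb n)
  solid _ _ h := lp.norm_mono (zero_lt_one.trans_le hp.out).ne' h

end lp

/-! ### A Banach lattice of functions with a prescribed quotient -/

/-! The obstruction is one Banach lattice, `Cover`, that maps onto `P` but has no bounded positive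
section. An element of it is a vector `x` with a function on `ℕ × Finset P` whose values at `(n, F)`
tend to the `n`-th coordinate of `x` as `F` grows. Its norm controls sums over admissible sets,
which are defined exactly so that `delta x` gives a lift of `x` of norm at most `2 * ‖x‖`. Hence `P`
is a quotient of the cover, and projectivity yields a bounded positive section `R`
(`Cover.exists_section`).

The function of `R (e n)` tends to 1 along `F`, so it exceeds 1/2 at some `(n, G n)`. However the
sets `G n` arise, `exists_admissible` finds `N` of these indices that form an admissible set. By
positivity, `R` of the sum of the corresponding `e n` exceeds 1/2 at all of them, so its norm is at
least `N / 2`. The sum itself has norm at most `√N`, which is impossible for large `N`. Unit vectors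
in `c₀`, and in `ℓ_p` with `p ≥ 2`, satisfy this growth bound. -/

/-- Coordinate functionals on a Banach lattice: lattice homomorphisms into `ℝ`, bounded by the
norm, which tend to zero at every vector. -/
structure NullCoordinates (P : Type u) [NormedAddCommGroup P] [NormedSpace ℝ P] [Lattice P] where
  coord : ℕ → P →ₗ[ℝ] ℝ
  map_sup : ∀ n x y, coord n (x ⊔ y) = coord n x ⊔ coord n y
  map_inf : ∀ n x y, coord n (x ⊓ y) = coord n x ⊓ coord n y
  abs_coord_le : ∀ n x, |coord n x| ≤ ‖x‖
  tendsto_zero : ∀ x, Tendsto (fun n => coord n x) atTop (𝓝 0)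

namespace NullCoordinates

variable {P : Type u} [NormedAddCommGroup P] [NormedSpace ℝ P] [Lattice P]

/-! ### Truncated coordinates and admissible sets -/

/-- The coordinates of `a`, seen only by the finite sets which contain `a`. -/
noncomputable def delta (c : NullCoordinates P) (a : P) (i : ℕ × Finset P) : ℝ :=
  open Classical in if a ∈ i.2 then c.coord i.1 a else 0

/-- A finite set of indices over which all functions `c.delta a` have sum at most `2 * ‖a‖`. -/
def Admissible (c : NullCoordinates P) (S : Finset (ℕ × Finset P)) : Prop :=
  ∀ a : P, ∑ i ∈ S, |c.delta a i| ≤ 2 * ‖a‖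

theorem abs_delta_le (c : NullCoordinates P) (a : P) (i : ℕ × Finset P) :
    |c.delta a i| ≤ ‖a‖ := by
  unfold delta
  split_ifs
  · exact c.abs_coord_le _ _
  · simp

/-- Makes the norm of the cover dominate each single value of the function component. -/
theorem admissible_singleton (c : NullCoordinates P) (i : ℕ × Finset P) : c.Admissible {i} := by
  intro a
  rw [Finset.sum_singleton]
  linarith [c.abs_delta_le a i, norm_nonneg a]

/-- The net is constant from `{a}` onwards. -/
theorem tendsto_delta (c : NullCoordinates P) (a : P) (n : ℕ) :
    Tendsto (fun F : Finset P => c.delta a (n, F)) atTop (𝓝 (c.coord n a)) := by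
  refine tendsto_const_nhds.congr' ?_
  filter_upwards [eventually_ge_atTop {a}] with F hF
  have : a ∈ F := hF (Finset.mem_singleton_self a)
  simp [delta, this]

/-! ### The cover as a normed vector lattice -/

/-- Pairs of a vector `x` and a function on `ℕ × Finset P` which is bounded in sum over admissible
sets and converges to the coordinates of `x` along the finite subsets of `P`. -/
def coverSubmodule (c : NullCoordinates P) : Submodule ℝ (P × (ℕ × Finset P → ℝ)) where
  carrier := {u | (∃ C, ∀ S, c.Admissible S → ∑ i ∈ S, |u.2 i| ≤ C) ∧
    ∀ n, Tendsto (fun F => u.2 (n, F)) atTop (𝓝 (c.coord n u.1))}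
  add_mem' := by
    rintro u v ⟨⟨C, hC⟩, hu⟩ ⟨⟨D, hD⟩, hv⟩
    refine ⟨⟨C + D, fun S hS => ?_⟩, fun n => ?_⟩
    · refine le_trans ?_ (add_le_add (hC S hS) (hD S hS))
      rw [← Finset.sum_add_distrib]
      exact Finset.sum_le_sum fun i _ => abs_add_le _ _
    · simpa using (hu n).add (hv n)
  zero_mem' := ⟨⟨0, by simp⟩, fun n => by simp⟩
  smul_mem' := by
    rintro r u ⟨⟨C, hC⟩, hu⟩
    refine ⟨⟨|r| * C, fun S hS => ?_⟩, fun n => ?_⟩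
    · refine le_trans (le_of_eq ?_) (mul_le_mul_of_nonneg_left (hC S hS) (abs_nonneg r))
      simp [Finset.mul_sum, abs_mul]
    · simpa using (hu n).const_mul r

/-- The vector lattice underlying `NullCoordinates.coverSubmodule`. -/
def Cover (c : NullCoordinates P) : Type u := c.coverSubmodule

namespace Cover

variable {c : NullCoordinates P}

instance : AddCommGroup c.Cover := inferInstanceAs (AddCommGroup c.coverSubmodule)

instance : Module ℝ c.Cover := inferInstanceAs (Module ℝ c.coverSubmodule)

/-- The inclusion into the product. -/
def incl (c : NullCoordinates P) : c.Cover →ₗ[ℝ] P × (ℕ × Finset P → ℝ) :=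
  c.coverSubmodule.subtype

/-- The vector component. -/
def vec (c : NullCoordinates P) : c.Cover →ₗ[ℝ] P := LinearMap.fst ℝ _ _ ∘ₗ incl c

/-- The function component. -/
def fn (c : NullCoordinates P) : c.Cover →ₗ[ℝ] (ℕ × Finset P → ℝ) := LinearMap.snd ℝ _ _ ∘ₗ incl c

theorem incl_injective : Function.Injective (incl c) := Subtype.val_injective

theorem ext {u v : c.Cover} (h₁ : vec c u = vec c v) (h₂ : fn c u = fn c v) : u = v :=
  incl_injective (Prod.ext h₁ h₂)

theorem exists_sum_le (u : c.Cover) : ∃ C, ∀ S, c.Admissible S → ∑ i ∈ S, |fn c u i| ≤ C := u.2.1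

theorem tendsto_fn (u : c.Cover) (n : ℕ) :
    Tendsto (fun F => fn c u (n, F)) atTop (𝓝 (c.coord n (vec c u))) := u.2.2 n

/-- Construction of an element from its two components. -/
def mk (x : P) (f : ℕ × Finset P → ℝ) (h₁ : ∃ C, ∀ S, c.Admissible S → ∑ i ∈ S, |f i| ≤ C)
    (h₂ : ∀ n, Tendsto (fun F => f (n, F)) atTop (𝓝 (c.coord n x))) : c.Cover :=
  ⟨(x, f), h₁, h₂⟩

theorem exists_sum_le_of_abs_le (u v : c.Cover) (f : ℕ × Finset P → ℝ)
    (hf : ∀ i, |f i| ≤ |fn c u i| + |fn c v i|) :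
    ∃ C, ∀ S, c.Admissible S → ∑ i ∈ S, |f i| ≤ C := by
  obtain ⟨C, hC⟩ := exists_sum_le u
  obtain ⟨D, hD⟩ := exists_sum_le v
  refine ⟨C + D, fun S hS => le_trans ?_ (add_le_add (hC S hS) (hD S hS))⟩
  rw [← Finset.sum_add_distrib]
  exact Finset.sum_le_sum fun i _ => hf i

instance : PartialOrder c.Cover := PartialOrder.lift (incl c) incl_injective

instance : Max c.Cover where
  max u v := mk (vec c u ⊔ vec c v) (fn c u ⊔ fn c v)
    (exists_sum_le_of_abs_le u v _ fun _ => abs_max_le_max_abs_abs.trans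
      (max_le_add_of_nonneg (abs_nonneg _) (abs_nonneg _)))
    fun n => by
      -- The limit condition survives suprema because the coordinates are lattice homomorphisms.
      rw [c.map_sup]
      exact (tendsto_fn u n).sup_nhds (tendsto_fn v n)

instance : Min c.Cover where
  min u v := mk (vec c u ⊓ vec c v) (fn c u ⊓ fn c v)
    (exists_sum_le_of_abs_le u v _ fun _ => abs_min_le_max_abs_abs.trans
      (max_le_add_of_nonneg (abs_nonneg _) (abs_nonneg _)))
    fun n => by
      rw [c.map_inf]
      exact (tendsto_fn u n).inf_nhds (tendsto_fn v n)

instance : Lattice c.Cover :=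
  Function.Injective.lattice (incl c) incl_injective .rfl .rfl (fun _ _ => rfl) fun _ _ => rfl

theorem vec_sup (u v : c.Cover) : vec c (u ⊔ v) = vec c u ⊔ vec c v := rfl

theorem vec_inf (u v : c.Cover) : vec c (u ⊓ v) = vec c u ⊓ vec c v := rfl

theorem fn_sup (u v : c.Cover) : fn c (u ⊔ v) = fn c u ⊔ fn c v := rfl

theorem vec_abs (u : c.Cover) : vec c |u| = |vec c u| := by
  change vec c (u ⊔ -u) = vec c u ⊔ -vec c u
  rw [vec_sup, map_neg]

theorem fn_abs (u : c.Cover) (i : ℕ × Finset P) : fn c |u| i = |fn c u i| := by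
  change fn c (u ⊔ -u) i = fn c u i ⊔ -fn c u i
  rw [fn_sup, map_neg]
  rfl

theorem vec_mono {u v : c.Cover} (h : u ≤ v) : vec c u ≤ vec c v :=
  (show incl c u ≤ incl c v from h).1

theorem fn_mono {u v : c.Cover} (h : u ≤ v) (i : ℕ × Finset P) : fn c u i ≤ fn c v i :=
  (show incl c u ≤ incl c v from h).2 i

/-- The larger of the norm of the vector component and the supremum of the sums of the absolute
value of the function component over admissible sets. -/
noncomputable instance : Norm c.Cover where
  norm u := ‖vec c u‖ ⊔ ⨆ S : {S // c.Admissible S}, ∑ i ∈ S.1, |fn c u i|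

theorem bddAbove_sum (u : c.Cover) :
    BddAbove (range fun S : {S // c.Admissible S} => ∑ i ∈ S.1, |fn c u i|) := by
  obtain ⟨C, hC⟩ := exists_sum_le u
  exact ⟨C, by rintro _ ⟨S, rfl⟩; exact hC S.1 S.2⟩

theorem norm_vec_le (u : c.Cover) : ‖vec c u‖ ≤ ‖u‖ := le_sup_left

theorem sum_abs_le_norm (u : c.Cover) {S : Finset (ℕ × Finset P)} (hS : c.Admissible S) :
    ∑ i ∈ S, |fn c u i| ≤ ‖u‖ :=
  (le_ciSup (bddAbove_sum u) ⟨S, hS⟩).trans le_sup_right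

theorem abs_fn_le_norm (u : c.Cover) (i : ℕ × Finset P) : |fn c u i| ≤ ‖u‖ := by
  simpa using sum_abs_le_norm u (c.admissible_singleton i)

theorem norm_le {u : c.Cover} {C : ℝ} (h₁ : ‖vec c u‖ ≤ C)
    (h₂ : ∀ S, c.Admissible S → ∑ i ∈ S, |fn c u i| ≤ C) : ‖u‖ ≤ C := by
  refine sup_le h₁ (Real.iSup_le (fun S => h₂ S.1 S.2) ((norm_nonneg _).trans h₁))

theorem norm_smul_le' (r : ℝ) (u : c.Cover) : ‖r • u‖ ≤ |r| * ‖u‖ := by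
  refine norm_le ?_ fun S hS => ?_
  · rw [map_smul, norm_smul, Real.norm_eq_abs]
    exact mul_le_mul_of_nonneg_left (norm_vec_le u) (abs_nonneg r)
  · rw [map_smul]
    simp only [Pi.smul_apply, smul_eq_mul, abs_mul, ← Finset.mul_sum]
    exact mul_le_mul_of_nonneg_left (sum_abs_le_norm u hS) (abs_nonneg r)

theorem norm_neg_le (u : c.Cover) : ‖-u‖ ≤ ‖u‖ := by
  simpa using norm_smul_le' (-1) u

noncomputable instance : NormedAddCommGroup c.Cover :=
  AddGroupNorm.toNormedAddCommGroup
    { toFun := fun u => ‖u‖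
      map_zero' := le_antisymm (norm_le (by simp) (by simp))
        ((norm_nonneg (vec c 0)).trans (norm_vec_le 0))
      add_le' := fun u v => by
        refine norm_le ?_ fun S hS => ?_
        · rw [map_add]
          exact (norm_add_le _ _).trans (add_le_add (norm_vec_le u) (norm_vec_le v))
        · refine le_trans ?_ (add_le_add (sum_abs_le_norm u hS) (sum_abs_le_norm v hS))
          rw [← Finset.sum_add_distrib, map_add]
          exact Finset.sum_le_sum fun i _ => abs_add_le _ _
      neg' := fun u => le_antisymm (norm_neg_le u) (by simpa using norm_neg_le (-u))
      eq_zero_of_map_eq_zero' := fun u hu => by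
        refine ext ?_ (funext fun i => ?_)
        · rw [map_zero]
          exact norm_le_zero_iff.1 ((norm_vec_le u).trans hu.le)
        · rw [map_zero]
          exact abs_nonpos_iff.1 ((abs_fn_le_norm u i).trans hu.le) }

noncomputable instance : NormedSpace ℝ c.Cover where
  norm_smul_le r u := norm_smul_le' r u

/-! ### Completeness and the Banach lattice axioms -/

/-- The limit of a pointwise convergent Cauchy sequence. -/
theorem exists_tendsto_of_cauchySeq [CompleteSpace P] {u : ℕ → c.Cover} (hu : CauchySeq u) :
    ∃ v, Tendsto u atTop (𝓝 v) := by
  have hd : ∀ ε > 0, ∃ N, ∀ m ≥ N, ∀ n ≥ N, ‖u m - u n‖ < ε := by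
    simpa only [dist_eq_norm] using Metric.cauchySeq_iff.1 hu
  have hx : CauchySeq fun k => vec c (u k) := by
    refine Metric.cauchySeq_iff.2 fun ε hε => ?_
    obtain ⟨N, hN⟩ := hd ε hε
    refine ⟨N, fun m hm n hn => lt_of_le_of_lt ?_ (hN m hm n hn)⟩
    rw [dist_eq_norm, ← map_sub]
    exact norm_vec_le _
  have hf : ∀ i, CauchySeq fun k => fn c (u k) i := by
    refine fun i => Metric.cauchySeq_iff.2 fun ε hε => ?_
    obtain ⟨N, hN⟩ := hd ε hε
    refine ⟨N, fun m hm n hn => lt_of_le_of_lt ?_ (hN m hm n hn)⟩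
    rw [Real.dist_eq, ← Pi.sub_apply, ← map_sub]
    exact abs_fn_le_norm _ i
  obtain ⟨x, hx⟩ := cauchySeq_tendsto_of_complete hx
  choose f hf using fun i => cauchySeq_tendsto_of_complete (hf i)
  -- Admissible sets are finite, so the Cauchy estimate passes to the pointwise limit with `N`
  -- independent of `S`.
  have hsum : ∀ ε > 0, ∃ N, ∀ n ≥ N, ∀ S, c.Admissible S →
      ∑ i ∈ S, |fn c (u n) i - f i| ≤ ε := by
    intro ε hε
    obtain ⟨N, hN⟩ := hd ε hε
    refine ⟨N, fun n hn S hS => ?_⟩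
    refine le_of_tendsto (x := atTop) (f := fun m => ∑ i ∈ S, |fn c (u n) i - fn c (u m) i|)
      (tendsto_finsetSum _ fun i _ => (tendsto_const_nhds.sub (hf i)).abs) ?_
    filter_upwards [eventually_ge_atTop N] with m hm
    refine le_trans ?_ (hN n hn m hm).le
    simpa using sum_abs_le_norm (u n - u m) hS
  refine ⟨mk x f ?_ fun n => ?_, ?_⟩
  · obtain ⟨N, hN⟩ := hsum 1 one_pos
    refine ⟨1 + ‖u N‖, fun S hS => ?_⟩
    refine le_trans ?_ (add_le_add (hN N le_rfl S hS) (sum_abs_le_norm (u N) hS))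
    rw [← Finset.sum_add_distrib]
    refine Finset.sum_le_sum fun i _ => ?_
    have h := abs_sub (fn c (u N) i) (fn c (u N) i - f i)
    rw [sub_sub_cancel] at h
    linarith
  -- Interchange of limits: compare with one late term of the sequence, close to `f` uniformly in
  -- `F`. The three errors are each at most `ε / 4`.
  · refine Metric.tendsto_nhds.2 fun ε hε => ?_
    obtain ⟨N, hN⟩ := hsum (ε / 4) (by positivity)
    obtain ⟨M, hM⟩ := Metric.tendsto_atTop.1 hx (ε / 4) (by positivity)
    have h₁ := hM (max N M) (le_max_right _ _)
    filter_upwards [Metric.tendsto_nhds.1 (tendsto_fn (u (max N M)) n) (ε / 4) (by positivity)]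
      with F hF
    have h₂ : |fn c (u (max N M)) (n, F) - f (n, F)| ≤ ε / 4 := by
      simpa using hN (max N M) (le_max_left _ _) _ (c.admissible_singleton (n, F))
    have h₃ := c.abs_coord_le n (vec c (u (max N M)) - x)
    rw [dist_eq_norm] at h₁
    rw [Real.dist_eq] at hF ⊢
    rw [map_sub] at h₃
    rw [abs_lt] at hF ⊢
    rw [abs_le] at h₂ h₃
    constructor <;> linarith [hF.1, hF.2, h₂.1, h₂.2, h₃.1, h₃.2]
  · refine Metric.tendsto_atTop.2 fun ε hε => ?_
    obtain ⟨N, hN⟩ := hsum (ε / 2) (by positivity)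
    obtain ⟨M, hM⟩ := Metric.tendsto_atTop.1 hx (ε / 2) (by positivity)
    refine ⟨max N M, fun n hn => ?_⟩
    rw [dist_eq_norm]
    refine lt_of_le_of_lt (norm_le (C := ε / 2) ?_ fun S hS => ?_) (by linarith)
    · rw [map_sub, ← dist_eq_norm]
      exact (hM n ((le_max_right _ _).trans hn)).le
    · rw [map_sub]
      exact hN n ((le_max_left _ _).trans hn) S hS

instance [BanachLattice P] : BanachLattice c.Cover where
  add_le_add_left u v h w := by
    change incl c (u + w) ≤ incl c (v + w)
    rw [map_add, map_add]
    exact add_le_add_left (show incl c u ≤ incl c v from h) _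
  smul_le_smul_of_nonneg_left r hr u v h := by
    refine ⟨smul_le_smul_of_nonneg_left (vec_mono h) hr, fun i => ?_⟩
    exact mul_le_mul_of_nonneg_left (fn_mono h i) hr
  smul_le_smul_of_nonneg_right u hu r s h := by
    have hu' : 0 ≤ vec c u := by simpa using vec_mono hu
    have hu'' : ∀ i, 0 ≤ fn c u i := fun i => by simpa using fn_mono hu i
    refine ⟨smul_le_smul_of_nonneg_right h hu', fun i => ?_⟩
    exact mul_le_mul_of_nonneg_right h (hu'' i)
  solid u v h := by
    refine norm_le ?_ fun S hS => ?_
    · refine le_trans (norm_le_norm_of_abs_le_abs ?_) (norm_vec_le v)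
      rw [← vec_abs, ← vec_abs]
      exact vec_mono h
    · refine le_trans (Finset.sum_le_sum fun i _ => ?_) (sum_abs_le_norm v hS)
      rw [← fn_abs, ← fn_abs]
      exact fn_mono h i
  complete := (Metric.complete_of_cauchySeq_tendsto
    fun _ => exists_tendsto_of_cauchySeq).complete

theorem isClosedIdeal_ker_vec [BanachLattice P] : IsClosedIdeal (LinearMap.ker (vec c)) where
  isClosed := by
    have h : Continuous (vec c) := by
      refine AddMonoidHomClass.continuous_of_bound (vec c) 1 fun u => ?_
      rw [one_mul]
      exact norm_vec_le u
    exact isClosed_singleton.preimage h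
  isSolid u hu v h := by
    have h₁ := vec_mono h
    have h₂ : vec c u = 0 := hu
    rw [vec_abs, vec_abs, h₂, abs_zero] at h₁
    exact le_antisymm ((le_abs_self _).trans h₁) (neg_nonpos.1 ((neg_le_abs _).trans h₁))

/-! ### `P` as a quotient of the cover -/

/-- The canonical preimage of a vector. -/
noncomputable def lift (c : NullCoordinates P) (x : P) : c.Cover :=
  mk x (c.delta x) ⟨2 * ‖x‖, fun _ hS => hS x⟩ (c.tendsto_delta x)

theorem vec_lift (x : P) : vec c (lift c x) = x := rfl

theorem norm_lift_le (x : P) : ‖lift c x‖ ≤ 2 * ‖x‖ := by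
  refine norm_le ?_ fun S hS => hS x
  rw [vec_lift]
  linarith [norm_nonneg x]

theorem mkQ_eq_mkQ_iff {u v : c.Cover} :
    (LinearMap.ker (vec c)).mkQ u = (LinearMap.ker (vec c)).mkQ v ↔ vec c u = vec c v := by
  rw [Submodule.mkQ_apply, Submodule.mkQ_apply, Submodule.Quotient.eq, LinearMap.mem_ker, map_sub,
    sub_eq_zero]

attribute [local instance] isClosedIdeal_ker_vec

/-- The identification of `P` with a quotient of the cover, as a lattice homomorphism. -/
noncomputable def toQuotient [BanachLattice P] (c : NullCoordinates P) :
    BanachLatticeHom P (c.Cover ⧸ LinearMap.ker (vec c)) where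
  toContinuousLinearMap := LinearMap.mkContinuous
    { toFun := fun x => (LinearMap.ker (vec c)).mkQ (lift c x)
      -- `lift` need not be additive; additivity holds modulo the kernel, where only vector
      -- components matter.
      map_add' := fun x y => by
        rw [← map_add, mkQ_eq_mkQ_iff]
        simp [vec_lift]
      map_smul' := fun r x => by
        rw [← map_smul, mkQ_eq_mkQ_iff]
        simp [vec_lift] }
    2 fun x => (Submodule.Quotient.norm_mk_le _ _).trans (norm_lift_le x)
  map_sup' x y := (mkQ_eq_mkQ_iff (v := lift c x ⊔ lift c y)).2 (by simp [vec_lift, vec_sup])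
  map_inf' x y := (mkQ_eq_mkQ_iff (v := lift c x ⊓ lift c y)).2 (by simp [vec_lift, vec_inf])

/-- An `∞`-projective lattice admits a bounded positive right inverse of the quotient map. -/
theorem exists_section [BanachLattice P] (c : NullCoordinates P) (h : IsInftyProjective P) :
    ∃ (C : ℝ) (R : P →L[ℝ] c.Cover), (∀ x, ‖R x‖ ≤ C * ‖x‖) ∧ (∀ x, vec c (R x) = x) ∧
      ∀ x, 0 ≤ x → 0 ≤ R x := by
  obtain ⟨l, -, hl⟩ := h
  obtain ⟨R, hR, -⟩ := hl c.Cover (LinearMap.ker (vec c)) (toQuotient c)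
  refine ⟨_, R.toContinuousLinearMap, R.toContinuousLinearMap.le_opNorm, fun x => ?_, fun x hx => ?_⟩
  · exact mkQ_eq_mkQ_iff.1 ((hR x).trans rfl)
  · have h₁ : R.toContinuousLinearMap (x ⊔ 0) =
        R.toContinuousLinearMap x ⊔ R.toContinuousLinearMap 0 := R.map_sup' x 0
    rw [sup_eq_left.2 hx, map_zero] at h₁
    rw [h₁]
    exact le_sup_right

end Cover

/-! ### Selecting admissible sets and the contradiction -/

/-- For every choice of finite sets `G n` there is an admissible set of `N` indices `(n, G n)`. -/
theorem exists_admissible (c : NullCoordinates P) (G : ℕ → Finset P) {N : ℕ} (hN : 0 < N) :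
    ∃ s : Finset ℕ, s.card = N ∧
      ∀ a : P, ∑ n ∈ s, |c.delta a (n, G n)| ≤ 2 * ‖a‖ := by
  -- Each new index is taken so late that all vectors in the finitely many earlier sets `G n`
  -- already have coordinates at most `‖a‖ / N`.
  obtain ⟨g, -, hg⟩ := exists_seq_of_forall_finset_exists (fun _ : ℕ => True)
    (fun n m => n < m ∧ ∀ a ∈ G n, |c.coord m a| ≤ ‖a‖ / N) (by
      intro s _
      have h₁ : ∀ n ∈ s, ∀ᶠ m in atTop, n < m ∧ ∀ a ∈ G n, |c.coord m a| ≤ ‖a‖ / N := by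
        intro n _
        refine (eventually_gt_atTop n).and ((Finset.eventually_all _).2 fun a _ => ?_)
        rcases eq_or_ne a 0 with rfl | ha
        · simp
        have hpos : 0 < ‖a‖ / N := div_pos (norm_pos_iff.2 ha) (Nat.cast_pos.2 hN)
        have h := (c.tendsto_zero a).abs
        rw [abs_zero] at h
        exact (h.eventually (gt_mem_nhds hpos)).mono fun _ => le_of_lt
      obtain ⟨m, hm⟩ := ((Finset.eventually_all s).2 h₁).exists
      exact ⟨m, trivial, hm⟩)
  have hmono : StrictMono g := fun m n h => (hg m n h).1
  refine ⟨(Finset.range N).map ⟨g, hmono.injective⟩, by simp, fun a => ?_⟩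
  rw [Finset.sum_map]
  simp only [Function.Embedding.coeFn_mk]
  have hN' : (N : ℝ) ≠ 0 := Nat.cast_ne_zero.2 hN.ne'
  -- The first set containing `a` contributes at most `‖a‖`, earlier ones nothing, and the later
  -- ones at most `‖a‖ / N` each: together at most `2 * ‖a‖`.
  by_cases hex : ∃ k, a ∈ G (g k)
  · classical
    have hle : ∀ k, |c.delta a (g k, G (g k))| ≤
        ‖a‖ / N + if k = Nat.find hex then ‖a‖ else 0 := by
      intro k
      split_ifs with hk
      · exact (c.abs_delta_le a _).trans (le_add_of_nonneg_left (by positivity))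
      · rw [add_zero]
        by_cases hmem : a ∈ G (g k)
        · have hlt := lt_of_le_of_ne (Nat.find_min' hex hmem) (Ne.symm hk)
          simpa [delta, hmem] using (hg _ _ hlt).2 a (Nat.find_spec hex)
        · simp only [delta, hmem, if_false, abs_zero]
          positivity
    refine (Finset.sum_le_sum fun k _ => hle k).trans ?_
    rw [Finset.sum_add_distrib, Finset.sum_const, Finset.card_range, nsmul_eq_mul,
      mul_div_cancel₀ _ hN', Finset.sum_ite_eq', two_mul]
    gcongr
    split_ifs <;> simp
  · rw [not_exists] at hex
    simp [delta, hex]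

/-- A Banach lattice with null coordinates and positive unit vectors whose sums grow at most like
the square root of the number of summands is not `∞`-projective. -/
theorem not_isInftyProjective [BanachLattice P] (c : NullCoordinates P) (e : ℕ → P)
    (he : ∀ n, 0 ≤ e n) (hc : ∀ n, c.coord n (e n) = 1)
    (hs : ∀ s : Finset ℕ, ‖∑ n ∈ s, e n‖ ^ 2 ≤ s.card) : ¬ IsInftyProjective P := by
  intro h
  obtain ⟨C, R, hC, hR, hpos⟩ := Cover.exists_section c h
  have hG : ∀ n, ∃ F : Finset P, 1 / 2 < Cover.fn c (R (e n)) (n, F) := by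
    intro n
    have h₁ := Cover.tendsto_fn (R (e n)) n
    rw [hR, hc] at h₁
    exact (h₁.eventually (lt_mem_nhds (by norm_num : (1 / 2 : ℝ) < 1))).exists
  choose G hG using hG
  -- With `N = k + 1` indices, `N / 2 ≤ C * √N` would force `N ≤ 4 * C ^ 2`.
  obtain ⟨k, hk⟩ := exists_nat_gt (4 * C ^ 2)
  obtain ⟨s, hcard, hadm⟩ := c.exists_admissible G k.succ_pos
  let f : ℕ ↪ ℕ × Finset P := ⟨fun n => (n, G n), fun m n h => congrArg Prod.fst h⟩
  have hS : c.Admissible (s.map f) := fun a => by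
    rw [Finset.sum_map]
    exact hadm a
  have h₁ := (Cover.sum_abs_le_norm (R (∑ n ∈ s, e n)) hS).trans (hC _)
  rw [Finset.sum_map] at h₁
  have h₂ : (s.card : ℝ) * (1 / 2) ≤ ∑ n ∈ s, |Cover.fn c (R (∑ n ∈ s, e n)) (f n)| := by
    rw [← nsmul_eq_mul]
    refine Finset.card_nsmul_le_sum _ _ _ fun n hn => (hG n).le.trans ?_
    refine le_trans ?_ (le_abs_self _)
    -- Positivity of `R` puts `R (e n)` below the image of the whole sum.
    refine Cover.fn_mono ?_ _
    rw [map_sum]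
    exact Finset.single_le_sum (f := fun m => R (e m)) (fun m _ => hpos _ (he m)) hn
  have h₃ := hs s
  have h₄ : ((s.card : ℝ) * (1 / 2)) ^ 2 ≤ (C * ‖∑ n ∈ s, e n‖) ^ 2 :=
    pow_le_pow_left₀ (by positivity) (h₂.trans h₁) 2
  rw [hcard] at h₃ h₄
  push_cast at h₃ h₄
  have h₅ : C ^ 2 * ‖∑ n ∈ s, e n‖ ^ 2 ≤ C ^ 2 * (k + 1) :=
    mul_le_mul_of_nonneg_left h₃ (sq_nonneg C)
  have h₆ : 0 < (k + 1 : ℝ) := by positivity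
  nlinarith

end NullCoordinates

/-! ### The coordinates of `c₀` and `ℓ_p` -/

namespace ZeroAtInftyContinuousMap

/-- The coordinates of a null sequence. -/
def nullCoordinates : NullCoordinates C₀(ℕ, ℝ) where
  coord n :=
    { toFun := fun f => f n
      map_add' := fun _ _ => rfl
      map_smul' := fun _ _ => rfl }
  map_sup _ _ _ := rfl
  map_inf _ _ _ := rfl
  abs_coord_le n f := by
    rw [← norm_toBCF_eq_norm]
    exact f.toBCF.norm_coe_le_norm n
  tendsto_zero f := by
    simpa [Nat.cofinite_eq_atTop] using zero_at_infty f

/-- The unit vectors of `c₀`. -/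
def unitVector (n : ℕ) : C₀(ℕ, ℝ) where
  toFun := Pi.single n 1
  continuous_toFun := continuous_of_discreteTopology
  zero_at_infty' := by
    rw [cocompact_eq_cofinite, Nat.cofinite_eq_atTop]
    refine tendsto_const_nhds.congr' ?_
    filter_upwards [eventually_gt_atTop n] with m hm
    simp [hm.ne']

theorem sum_unitVector_apply (s : Finset ℕ) (m : ℕ) :
    (∑ n ∈ s, unitVector n) m = if m ∈ s then 1 else 0 := by
  have h := map_sum (nullCoordinates.coord m) unitVector s
  refine h.trans ?_
  change ∑ n ∈ s, Pi.single (M := fun _ => ℝ) n 1 m = _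
  simp [Pi.single_apply]

theorem norm_sum_unitVector_le (s : Finset ℕ) : ‖∑ n ∈ s, unitVector n‖ ^ 2 ≤ s.card := by
  rcases s.eq_empty_or_nonempty with rfl | hs
  · simp
  have h : ‖∑ n ∈ s, unitVector n‖ ≤ 1 := by
    rw [← norm_toBCF_eq_norm]
    refine (BoundedContinuousFunction.norm_le zero_le_one).2 fun m => ?_
    change ‖(∑ n ∈ s, unitVector n) m‖ ≤ 1
    rw [sum_unitVector_apply]
    split_ifs <;> simp
  have h₁ : (1 : ℝ) ≤ s.card := by exact_mod_cast hs.card_pos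
  exact (pow_le_one₀ (norm_nonneg _) h).trans h₁

end ZeroAtInftyContinuousMap

namespace lp

variable {p : ℝ≥0∞} [Fact (1 ≤ p)]

/-- The coordinates of a `p`-summable sequence, `p < ∞`. -/
def nullCoordinates (hp : p < ∞) : NullCoordinates (lp (fun _ : ℕ => ℝ) p) where
  coord n :=
    { toFun := fun f => f n
      map_add' := fun _ _ => rfl
      map_smul' := fun _ _ => rfl }
  map_sup _ _ _ := rfl
  map_inf _ _ _ := rfl
  abs_coord_le n f := lp.norm_apply_le_norm (zero_lt_one.trans_le Fact.out).ne' f n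
  tendsto_zero f := by
    have h0 : 0 < p.toReal :=
      ENNReal.toReal_pos (zero_lt_one.trans_le (Fact.out : 1 ≤ p)).ne' hp.ne
    -- The summands `‖f n‖ ^ p` tend to zero; take `p`-th roots.
    have h := ((lp.memℓp f).summable h0).tendsto_atTop_zero.rpow_const
      (p := p.toReal⁻¹) (Or.inr (by positivity))
    rw [Real.zero_rpow (inv_pos.2 h0).ne'] at h
    refine tendsto_zero_iff_norm_tendsto_zero.2 (h.congr fun n => ?_)
    exact Real.rpow_rpow_inv (norm_nonneg _) h0.ne'

/-- The norm `x` satisfies `x ^ p = s.card`, and `x ^ 2 ≤ x ^ p` when `x ≥ 1`; this is where `p ≥ 2`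
enters. -/
theorem norm_sum_single_one_le (h2 : 2 ≤ p) (hp : p < ∞) (s : Finset ℕ) :
    ‖∑ n ∈ s, (lp.single p n 1 : lp (fun _ : ℕ => ℝ) p)‖ ^ 2 ≤ s.card := by
  rcases s.eq_empty_or_nonempty with rfl | hs
  · simp
  have h2' : 2 ≤ p.toReal := by
    simpa using ENNReal.toReal_mono hp.ne h2
  have h := lp.norm_sum_single (E := fun _ : ℕ => ℝ) (p := p) (by linarith) (fun _ => 1) s
  have h₁ : (1 : ℝ) ≤ s.card := by exact_mod_cast hs.card_pos
  simp only [norm_one, Real.one_rpow, Finset.sum_const, nsmul_eq_mul, mul_one] at h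
  set x := ‖∑ n ∈ s, (lp.single p n 1 : lp (fun _ : ℕ => ℝ) p)‖
  have hx : 0 ≤ x := norm_nonneg _
  rcases le_total x 1 with hx1 | hx1
  · exact (pow_le_one₀ hx hx1).trans h₁
  · rw [← h, ← Real.rpow_natCast]
    exact Real.rpow_le_rpow_of_exponent_le hx1 (by simpa using h2')

end lp

theorem mainTheorem4 :
    ¬ IsInftyProjective C₀(ℕ, ℝ) ∧
      ∀ (p : ℝ≥0∞) [Fact (1 ≤ p)], 2 ≤ p → p < ∞ →
        ¬ IsInftyProjective (lp (fun _ : ℕ => ℝ) p) := by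
  refine ⟨?_, fun p _ h2 hp => ?_⟩
  · refine ZeroAtInftyContinuousMap.nullCoordinates.not_isInftyProjective
      ZeroAtInftyContinuousMap.unitVector (fun n m => ?_) (fun n => ?_)
      ZeroAtInftyContinuousMap.norm_sum_unitVector_le
    · change (0 : ℝ) ≤ Pi.single (M := fun _ => ℝ) n 1 m
      rw [Pi.single_apply]
      split_ifs <;> simp
    · exact Pi.single_eq_same (M := fun _ => ℝ) n 1
  · refine (lp.nullCoordinates hp).not_isInftyProjective (fun n => lp.single p n 1)
      (fun n m => ?_) (fun n => ?_) (lp.norm_sum_single_one_le h2 hp)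
    · change (0 : ℝ) ≤ (lp.single p n 1 : lp (fun _ : ℕ => ℝ) p) m
      rw [lp.single_apply, Pi.single_apply]
      split_ifs <;> simp
    · exact lp.single_apply_self p n 1
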